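/- Consider four point vortices of equal intensity $\Gamma_i=1$ in the plane, at positions $z_k=x_k+iy_k$, moving without collisions (for all times $t\in\mathbb R$) according to $$\dot x_k=\frac{\partial\mathcal H}{\partial y_k},\qquad \dot y_k=-\frac{\partial\mathcal H}{\partial x_k},\qquad \mathcal H=-\frac1{4\pi}\sum_{i<j}\ln|z_i-z_j|^2,$$ with centre of vorticity at the origin, $\sum_k x_k=\sum_k y_k=0$, and let $I=\sum_k(x_k^2+y_k^2)$. Suppose that at some time $t_0$ the vortices form a centrosymmetric configuration (a parallelogram, possibly degenerate) and that the constants of motion $\mathcal H$ and $I$ satisfy $$\frac{2\pi}{3}\mathcal H+\ln I<\frac16\ln 108 .$$ Then the motion is a simple relative choreography: there are an angular velocity $\Omega\in\mathbb R$, a closed curve given by a continuous function $u:\mathbb R\to\mathbb C$ of some period $\tau>0$, and time lags $s_1,\dots,s_4\in\mathbb R$ such that $$e^{-i\Omega t}z_k(t)=u(t+s_k)\qquad\text{for all }t\in\mathbb R,\ k=1,\dots,4,$$ that is, in the frame rotating about the origin with angular velocity $\Omega$ all four vortices trace the same closed curve. -/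

import Mathlib

open Complex

noncomputable section

namespace PointVortex

variable {n : ℕ}

/-- The Hamiltonian `-(1/4π) ∑_{i<j} Γᵢ Γⱼ ln |rᵢ - rⱼ|²` of `n` point vortices on the plane, the
position of the `i`-th vortex being written as the complex number `xᵢ + i yᵢ`. -/
def hamiltonian (Γ : Fin n → ℝ) (z : Fin n → ℂ) : ℝ :=
  -(1 / (4 * Real.pi)) *
    ∑ i, ∑ j ∈ Finset.Ioi i, Γ i * Γ j * Real.log (‖z i - z j‖ ^ 2)

/-- The partial derivative of `F` with respect to the `x`-coordinate of the `i`-th vortex. -/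
def partialX (F : (Fin n → ℂ) → ℝ) (i : Fin n) (z : Fin n → ℂ) : ℝ :=
  deriv (fun s : ℝ => F (Function.update z i (z i + (s : ℂ)))) 0

/-- The partial derivative of `F` with respect to the `y`-coordinate of the `i`-th vortex. -/
def partialY (F : (Fin n → ℂ) → ℝ) (i : Fin n) (z : Fin n → ℂ) : ℝ :=
  deriv (fun s : ℝ => F (Function.update z i (z i + (s : ℂ) * I))) 0

/-- `z` is a motion of point vortices with intensities `Γ`: a collision-free solution of
`Γᵢ ẋᵢ = ∂H/∂yᵢ`, `Γᵢ ẏᵢ = -∂H/∂xᵢ`. -/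
structure IsMotion (Γ : Fin n → ℝ) (z : ℝ → Fin n → ℂ) : Prop where
  noCollision : ∀ t, Function.Injective (z t)
  differentiable : ∀ i, Differentiable ℝ (fun t => z t i)
  eq_x : ∀ t i, Γ i * deriv (fun s => (z s i).re) t = partialY (hamiltonian Γ) i (z t)
  eq_y : ∀ t i, Γ i * deriv (fun s => (z s i).im) t = -partialX (hamiltonian Γ) i (z t)

/-- The first integral `Q = ∑ Γᵢ xᵢ`. -/
def integralQ (Γ : Fin n → ℝ) (z : Fin n → ℂ) : ℝ := ∑ i, Γ i * (z i).re

/-- The first integral `P = ∑ Γᵢ yᵢ`. -/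
def integralP (Γ : Fin n → ℝ) (z : Fin n → ℂ) : ℝ := ∑ i, Γ i * (z i).im

/-- The first integral `I = ∑ Γᵢ (xᵢ² + yᵢ²)`. -/
def integralI (Γ : Fin n → ℝ) (z : Fin n → ℂ) : ℝ := ∑ i, Γ i * ((z i).re ^ 2 + (z i).im ^ 2)

/-- The configuration is mapped to itself by the reflection in some point `c` of the plane.
For four distinct points this says that they are the vertices of a (possibly degenerate)
parallelogram, in some order. -/
def IsCentrosymmetric (z : Fin n → ℂ) : Prop :=
  ∃ (c : ℂ) (σ : Equiv.Perm (Fin n)), ∀ i, z (σ i) = 2 * c - z i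

/-- The motion `z` is a simple relative choreography: in the frame of reference that rotates about
the origin with some constant angular velocity `Ω`, all vortices run along one and the same closed
curve `u`, following each other with constant time lags. -/
def IsSimpleRelativeChoreography (z : ℝ → Fin n → ℂ) : Prop :=
  ∃ (Ω τ : ℝ) (u : ℝ → ℂ) (s : Fin n → ℝ),
    0 < τ ∧ Continuous u ∧ Function.Periodic u τ ∧
      ∀ k t, Complex.exp (-((Ω * t : ℝ) : ℂ) * I) * z t k = u (t + s k)

end PointVortex

end

/-! By uniqueness, central symmetry persists, so the vortices are `y 0, y 1, -y 0, -y 1`. Put `X =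
|y 0|² - |y 1|²` and `U + iV = y 0 * conj (y 1)`, which determine the parallelogram up to rotation.
With `S = |y 0|² + |y 1|²` conserved, `(X, 2U, 2V)` moves on a sphere of radius `S`, and
conservation of energy becomes constancy of `E = (S² - X²)(S² - 4U²)²`.

On the equator `V = 0` (collinear vortices) `27E ≤ 4S⁶`, whereas the hypothesis on `H` and `I` says
exactly `27E > 4S⁶`. Hence `V` keeps its sign, and the orbit circles the square configuration `X = U
= 0` with angular velocity bounded below. As `E` is even and strictly monotone along rays, the orbit
passes through `(-X, -U, V)` after some time `h` (`exists_half_turn`).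

That point is the initial parallelogram with its diagonals exchanged: up to a rotation `w`, vortex
`k` has taken the place of vortex `k + 1` (`exists_swap_of_level`). Uniqueness makes this relation
hold at all times, and a frame turning by `arg w` in time `h` turns it into a choreography of period
`4h` (`isSimpleRelativeChoreography_of_shift`). -/

namespace PointVortex

/-! ### Equations of motion in complex form -/

/-- The velocity field of `n` vortices of unit intensity. The term `j = k` vanishes. -/
noncomputable def velocity {n : ℕ} (z : Fin n → ℂ) (k : Fin n) : ℂ :=
  I / (2 * Real.pi) * (starRingEnd ℂ) (∑ j, (z k - z j)⁻¹)

/-- The sum over all ordered pairs makes invariance under relabelling visible; its diagonal terms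
vanish because `Real.log 0 = 0`. -/
theorem hamiltonian_one_eq {n : ℕ} (z : Fin n → ℂ) :
    hamiltonian (fun _ => 1) z =
      -(1 / (8 * Real.pi)) * ∑ i, ∑ j, Real.log (‖z i - z j‖ ^ 2) := by
  have h := Finset.sum_sum_Ioi_add_eq_sum_sum_off_diag
    (fun i j : Fin n => Real.log (‖z i - z j‖ ^ 2))
  have h1 : ∀ i, ∑ j ∈ ({i}ᶜ : Finset (Fin n)), Real.log (‖z j - z i‖ ^ 2)
      = ∑ j, Real.log (‖z i - z j‖ ^ 2) := by
    intro i
    rw [← Finset.sum_compl_add_sum {i}]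
    simp [norm_sub_rev]
  have h2 : ∀ i j : Fin n, Real.log (‖z j - z i‖ ^ 2) + Real.log (‖z i - z j‖ ^ 2)
      = 2 * Real.log (‖z i - z j‖ ^ 2) := by
    intro i j
    rw [norm_sub_rev, two_mul]
  simp only [h1, h2, ← Finset.mul_sum] at h
  rw [hamiltonian, ← h]
  simp only [one_mul]
  ring

theorem hamiltonian_one_comp {n : ℕ} (z : Fin n → ℂ) (e : Equiv.Perm (Fin n)) :
    hamiltonian (fun _ => 1) (fun k => z (e k)) = hamiltonian (fun _ => 1) z := by
  rw [hamiltonian_one_eq, hamiltonian_one_eq,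
    ← Equiv.sum_comp e (fun i => ∑ j, Real.log (‖z i - z j‖ ^ 2))]
  congr 2
  ext i
  rw [← Equiv.sum_comp e (fun j => Real.log (‖z (e i) - z j‖ ^ 2))]

theorem hasDerivAt_log_norm_sq_add_mul {c : ℂ} (hc : c ≠ 0) (d : ℂ) :
    HasDerivAt (fun s : ℝ => Real.log (‖c + s * d‖ ^ 2)) (2 * (d * c⁻¹).re) 0 := by
  have h1 : HasDerivAt (fun s : ℝ => c + (s : ℂ) * d) d 0 := by
    simpa using ((Complex.ofRealCLM.hasDerivAt (x := (0 : ℝ))).mul_const d).const_add c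
  have h2 := h1.norm_sq.log (by simpa using hc)
  refine h2.congr_deriv ?_
  simp only [ofReal_zero, zero_mul, add_zero, Complex.inner, Complex.inv_def,
    Complex.normSq_eq_norm_sq]
  have : ‖c‖ ≠ 0 := by simpa using hc
  rw [← mul_assoc, Complex.re_mul_ofReal, mul_div_assoc, mul_comm d]
  ring

theorem hasDerivAt_hamiltonian_one {n : ℕ} {z : Fin n → ℂ} (hz : Function.Injective z)
    (i : Fin n) (d : ℂ) :
    HasDerivAt (fun s : ℝ => hamiltonian (fun _ => 1) (Function.update z i (z i + s * d)))
      (-(1 / (2 * Real.pi)) * (d * ∑ j, (z i - z j)⁻¹).re) 0 := by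
  simp only [hamiltonian_one_eq]
  -- `δ p` is the velocity of point `p` when only vortex `i` is displaced, in direction `d`.
  set δ : Fin n → ℂ := fun p => if p = i then d else 0 with hδ
  have h1 : ∀ p q : Fin n, HasDerivAt (fun s : ℝ => Real.log
      (‖Function.update z i (z i + s * d) p - Function.update z i (z i + s * d) q‖ ^ 2))
      (2 * ((δ p - δ q) * (z p - z q)⁻¹).re) 0 := by
    intro p q
    by_cases hpq : p = q
    · subst hpq
      simpa using hasDerivAt_const (0 : ℝ) (0 : ℝ)
    · convert hasDerivAt_log_norm_sq_add_mul (sub_ne_zero.2 (hz.ne hpq))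
        (δ p - δ q) using 4 with s
      have : ∀ r, Function.update z i (z i + s * d) r = z r + s * δ r := by
        intro r
        by_cases hr : r = i
        · subst hr; simp [hδ]
        · simp [hδ, hr]
      rw [this, this]
      ring_nf
  refine ((HasDerivAt.fun_sum fun p (_ : p ∈ Finset.univ) =>
    HasDerivAt.fun_sum fun q (_ : q ∈ Finset.univ) => h1 p q).const_mul
      (-(1 / (8 * Real.pi)))).congr_deriv ?_
  have h3 : ∑ p, ∑ q, (δ p - δ q) * (z p - z q)⁻¹
      = 2 * (d * ∑ j, (z i - z j)⁻¹) := by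
    simp only [sub_mul, Finset.sum_sub_distrib]
    rw [Finset.sum_comm (f := fun p q => δ q * (z p - z q)⁻¹)]
    simp only [← Finset.mul_sum]
    have h4 : ∀ g : Fin n → ℂ, ∑ p, δ p * g p = d * g i := by
      intro g
      simp [hδ, ite_mul]
    rw [h4, h4]
    have h5 : ∑ j, (z j - z i)⁻¹ = - ∑ j, (z i - z j)⁻¹ := by
      rw [← Finset.sum_neg_distrib]
      refine Finset.sum_congr rfl fun j _ => ?_
      rw [← inv_neg, neg_sub]
    rw [h5]
    ring
  have h6 := congrArg Complex.re h3
  simp only [Complex.re_sum] at h6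
  simp only [← Finset.mul_sum]
  rw [h6]
  simp only [Complex.mul_re, re_ofNat, im_ofNat]
  ring

theorem IsMotion.hasDerivAt {n : ℕ} {z : ℝ → Fin n → ℂ} (hz : IsMotion (fun _ => 1) z)
    (t : ℝ) (k : Fin n) : HasDerivAt (fun s => z s k) (velocity (z t) k) t := by
  have hd := (hz.differentiable k t).hasDerivAt
  have hx := hz.eq_x t k
  have hy := hz.eq_y t k
  have hre : HasDerivAt (fun s => (z s k).re) (deriv (fun s => z s k) t).re t :=
    Complex.reCLM.hasFDerivAt.comp_hasDerivAt t hd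
  have him : HasDerivAt (fun s => (z s k).im) (deriv (fun s => z s k) t).im t :=
    Complex.imCLM.hasFDerivAt.comp_hasDerivAt t hd
  have hX := (hasDerivAt_hamiltonian_one (hz.noCollision t) k 1).deriv
  have hY := (hasDerivAt_hamiltonian_one (hz.noCollision t) k I).deriv
  simp only [mul_one] at hX
  rw [hre.deriv, one_mul, partialY, hY] at hx
  rw [him.deriv, one_mul, partialX, hX] at hy
  suffices velocity (z t) k = deriv (fun s => z s k) t from this ▸ hd
  have hI : I / (2 * Real.pi) = ((1 / (2 * Real.pi) : ℝ) : ℂ) * I := by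
    push_cast
    ring
  rw [velocity, hI]
  set F := ∑ j, (z t k - z t j)⁻¹
  apply Complex.ext
  · rw [hx, mul_assoc, Complex.re_ofReal_mul]
    simp
  · rw [hy, mul_assoc, Complex.im_ofReal_mul]
    simp

/-! ### Uniqueness and symmetries of motions -/

/-- A collision-free solution of the complex form of the equations of motion of vortices of unit
intensity. -/
structure IsUnitMotion {n : ℕ} (z : ℝ → Fin n → ℂ) : Prop where
  injective : ∀ t, Function.Injective (z t)
  hasDerivAt : ∀ t k, HasDerivAt (fun s => z s k) (velocity (z t) k) t

theorem IsMotion.isUnitMotion {n : ℕ} {z : ℝ → Fin n → ℂ} (hz : IsMotion (fun _ => 1) z) :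
    IsUnitMotion z :=
  ⟨hz.noCollision, hz.hasDerivAt⟩

theorem contDiffAt_velocity {n : ℕ} {z : Fin n → ℂ} (hz : Function.Injective z) :
    ContDiffAt ℝ 1 (velocity (n := n)) z := by
  rw [contDiffAt_pi]
  intro k
  have h : ContDiffAt ℝ 1 (fun y : Fin n → ℂ => ∑ j, (y k - y j)⁻¹) z := by
    refine ContDiffAt.sum fun j _ => ?_
    by_cases hj : k = j
    · subst hj
      simpa using contDiffAt_const
    · exact ContDiffAt.inv (by fun_prop) (sub_ne_zero.2 (hz.ne hj))
  exact contDiffAt_const.mul (Complex.conjCLE.contDiff.contDiffAt.comp z h)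

namespace IsUnitMotion

variable {n : ℕ} {y z : ℝ → Fin n → ℂ}

theorem hasDerivAt_pi (hz : IsUnitMotion z) (t : ℝ) : HasDerivAt z (velocity (z t)) t :=
  _root_.hasDerivAt_pi.2 (hz.hasDerivAt t)

theorem continuous (hz : IsUnitMotion z) : Continuous z :=
  continuous_iff_continuousAt.2 fun t => (hz.hasDerivAt_pi t).continuousAt

/-- The velocity field is Lipschitz only locally, away from collisions; local uniqueness makes the
coincidence set open, and it is closed by continuity. -/
theorem eq_of_eq_at (hy : IsUnitMotion y) (hz : IsUnitMotion z) {t₀ : ℝ} (h : y t₀ = z t₀) :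
    y = z := by
  have hclosed : IsClosed {t | y t = z t} := isClosed_eq hy.continuous hz.continuous
  have hopen : IsOpen {t | y t = z t} := by
    rw [isOpen_iff_mem_nhds]
    intro t ht
    obtain ⟨K, s, hs, hK⟩ := (contDiffAt_velocity (hz.injective t)).exists_lipschitzOnWith
    refine ODE_solution_unique_of_eventually (v := fun _ => velocity) (s := fun _ => s) (K := K)
      (Filter.Eventually.of_forall fun _ => hK) ?_ ?_ ht
    · have : y ⁻¹' s ∈ nhds t := hy.continuous.continuousAt (by rwa [show y t = z t from ht])
      filter_upwards [this] with r hr using ⟨hy.hasDerivAt_pi r, hr⟩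
    · have : z ⁻¹' s ∈ nhds t := hz.continuous.continuousAt hs
      filter_upwards [this] with r hr using ⟨hz.hasDerivAt_pi r, hr⟩
  have huniv := IsClopen.eq_univ ⟨hclosed, hopen⟩ ⟨t₀, h⟩
  funext t
  have : t ∈ {t | y t = z t} := huniv ▸ Set.mem_univ t
  exact this

theorem comp_add_const (hz : IsUnitMotion z) (h : ℝ) : IsUnitMotion fun t => z (t + h) :=
  ⟨fun _ => hz.injective _, fun t k => (hz.hasDerivAt (t + h) k).comp_add_const t h⟩

/-- The field is built from conjugated inverses, and `(conj w)⁻¹ = w` on the unit circle. -/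
theorem rotate_comp_perm (hz : IsUnitMotion z) {w : ℂ} (hw : ‖w‖ = 1)
    (e : Equiv.Perm (Fin n)) : IsUnitMotion fun t k => w * z t (e k) := by
  have hw0 : w ≠ 0 := norm_ne_zero_iff.1 (hw ▸ one_ne_zero)
  refine ⟨fun t => (mul_right_injective₀ hw0).comp ((hz.injective t).comp e.injective),
    fun t k => ?_⟩
  refine ((hz.hasDerivAt t (e k)).const_mul w).congr_deriv ?_
  simp only [velocity, ← mul_sub, mul_inv, ← Finset.mul_sum, map_mul,
    Equiv.sum_comp e (fun j => (z t (e k) - z t j)⁻¹), map_inv₀]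
  have : ((starRingEnd ℂ) w)⁻¹ = w := by
    rw [← map_inv₀, Complex.inv_eq_conj hw, Complex.conj_conj]
  rw [this]
  ring

/-- A relation between two phases of a motion by a rotation and a relabelling persists. -/
theorem rotate_comp_perm_eq (hz : IsUnitMotion z) {w : ℂ} (hw : ‖w‖ = 1)
    (e : Equiv.Perm (Fin n)) {h t₀ : ℝ} (h₀ : ∀ k, z (t₀ + h) k = w * z t₀ (e k)) (t : ℝ)
    (k : Fin n) : z (t + h) k = w * z t (e k) :=
  congrFun (congrFun ((hz.comp_add_const h).eq_of_eq_at (hz.rotate_comp_perm hw e)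
    (funext h₀)) t) k

end IsUnitMotion

/-! ### From a time shift to a choreography -/

/-- A motion in which, after some time, each vortex has taken the place of the next one up to a
rotation, is a simple relative choreography. -/
theorem isSimpleRelativeChoreography_of_shift {z : ℝ → Fin 4 → ℂ}
    (hz : Continuous fun t => z t 0) (e : Equiv.Perm (Fin 4)) {h : ℝ} (hh : 0 < h) {w : ℂ}
    (hw : ‖w‖ = 1) (hs : ∀ t k, z (t + h) k = w * z t (k + 1)) :
    IsSimpleRelativeChoreography fun t k => z t (e k) := by
  have hw0 : w ≠ 0 := norm_ne_zero_iff.1 (hw ▸ one_ne_zero)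
  -- The frame turns by exactly `arg w` in time `h`, which cancels the factor `w`.
  set Ω : ℝ := w.arg / h
  have hΩ : Complex.exp (-((Ω * h : ℝ) : ℂ) * I) * w = 1 := by
    have h1 : Ω * h = w.arg := div_mul_cancel₀ _ hh.ne'
    have h2 : Complex.exp ((w.arg : ℂ) * I) = w := by
      simpa [hw] using Complex.norm_mul_exp_arg_mul_I w
    rw [h1, neg_mul, Complex.exp_neg, h2, inv_mul_cancel₀ hw0]
  set ζ : ℝ → Fin 4 → ℂ := fun t k => Complex.exp (-((Ω * t : ℝ) : ℂ) * I) * z t k with hζ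
  have hstep : ∀ t k, ζ (t + h) k = ζ t (k + 1) := by
    intro t k
    have : Complex.exp (-((Ω * (t + h) : ℝ) : ℂ) * I)
        = Complex.exp (-((Ω * t : ℝ) : ℂ) * I) * Complex.exp (-((Ω * h : ℝ) : ℂ) * I) := by
      rw [← Complex.exp_add]
      push_cast
      ring_nf
    simp only [hζ, hs, this]
    linear_combination (Complex.exp (-((Ω * t : ℝ) : ℂ) * I) * z t (k + 1)) * hΩ
  have hlag : ∀ m : ℕ, ∀ t, ζ (t + m * h) 0 = ζ t (Fin.ofNat 4 m) := by
    intro m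
    induction m with
    | zero => intro t; simp
    | succ m ih =>
      intro t
      have h1 : Fin.ofNat 4 (m + 1) = Fin.ofNat 4 m + 1 := by
        simp [Fin.ext_iff, Fin.val_add]
      rw [h1, ← hstep, ← ih]
      push_cast
      ring_nf
  -- The common curve is that of vortex `0`; four shifts return to index `0` in `Fin 4`, whence the
  -- period `4 * h`.
  refine ⟨Ω, 4 * h, fun t => ζ t 0, fun k => (e k : ℕ) * h, by positivity, by fun_prop, ?_, ?_⟩
  · intro t
    simpa using hlag 4 t
  · intro k t
    simp only [hlag, Fin.ofNat_val_eq_self]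
    rfl

/-! ### Dynamics on the reduced sphere -/

/-- The difference of the two sides is `(3y - S²)²(4S² - 3y)`. With `y = 4U²` this bounds the energy
function on the equator `V = 0`. -/
theorem twentySeven_mul_sq_le {S y : ℝ} (hy : y ≤ S ^ 2) :
    27 * (y * (S ^ 2 - y) ^ 2) ≤ 4 * S ^ 6 := by
  nlinarith [mul_nonneg (sq_nonneg (3 * y - S ^ 2)) (by nlinarith : 0 ≤ 4 * S ^ 2 - 3 * y)]

/-- The scale by which a point is moved radially along a level curve of
`(S² - X²)(S² - 4U²)²` is `1`. -/
theorem radial_scale_eq_one {S X U r : ℝ} (hr : 0 < r) (hne : X ≠ 0 ∨ U ≠ 0)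
    (hX : 0 < S ^ 2 - X ^ 2) (hU : 0 < S ^ 2 - 4 * U ^ 2)
    (hX' : 0 < S ^ 2 - (r * X) ^ 2) (hU' : 0 < S ^ 2 - 4 * (r * U) ^ 2)
    (hE : (S ^ 2 - (r * X) ^ 2) * (S ^ 2 - 4 * (r * U) ^ 2) ^ 2
      = (S ^ 2 - X ^ 2) * (S ^ 2 - 4 * U ^ 2) ^ 2) : r = 1 := by
  have key : ∀ {A B A' B' : ℝ}, 0 < A' → 0 < B' → A' ≤ A → B' ≤ B → A' < A ∨ B' < B →
      A' * B' ^ 2 < A * B ^ 2 := by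
    intro A B A' B' hA hB hAA hBB h
    rcases h with h | h
    · exact mul_lt_mul h (by gcongr) (by positivity) (by linarith)
    · exact mul_lt_mul' hAA (by gcongr) (by positivity) (by linarith)
  rcases lt_trichotomy r 1 with h | h | h
  · exfalso
    have hr2 : r ^ 2 < 1 := by nlinarith
    refine (key hX hU ?_ ?_ ?_).ne hE.symm
    · nlinarith [sq_nonneg X]
    · nlinarith [sq_nonneg U]
    · rcases hne with h0 | h0
      · left; nlinarith [sq_pos_of_ne_zero h0]
      · right; nlinarith [sq_pos_of_ne_zero h0]
  · exact h
  · exfalso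
    have hr2 : 1 < r ^ 2 := by nlinarith
    refine (key hX' hU' ?_ ?_ ?_).ne hE
    · nlinarith [sq_nonneg X]
    · nlinarith [sq_nonneg U]
    · rcases hne with h0 | h0
      · left; nlinarith [sq_pos_of_ne_zero h0]
      · right; nlinarith [sq_pos_of_ne_zero h0]

/-- A nonvanishing plane curve whose angular velocity is bounded below by a positive constant
points in the direction opposite to the initial one at some later time. -/
theorem exists_opposite_of_angular_velocity {W W' : ℝ → ℂ} {c : ℝ} (hc : 0 < c) (t₀ : ℝ)
    (hW : ∀ t, HasDerivAt W (W' t) t) (hW' : Continuous W') (h0 : ∀ t, W t ≠ 0)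
    (hang : ∀ t, c ≤ (W' t / W t).im) :
    ∃ h > 0, ∃ r : ℝ, 0 < r ∧ W (t₀ + h) = -(r * W t₀) := by
  have hWc : Continuous W := continuous_iff_continuousAt.2 fun t => (hW t).continuousAt
  have hg : Continuous fun t => W' t / W t := hW'.div hWc h0
  -- `ℓ` is a continuous logarithm of `W / W t₀`; its imaginary part grows at rate at least `c`, so
  -- it takes the value `π`.
  set ℓ : ℝ → ℂ := fun t => ∫ s in t₀..t, W' s / W s with hℓ
  have hℓd : ∀ t, HasDerivAt ℓ (W' t / W t) t := fun t =>
    intervalIntegral.integral_hasDerivAt_right (hg.intervalIntegrable _ _)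
      (hg.stronglyMeasurableAtFilter _ _) hg.continuousAt
  have hℓ0 : ℓ t₀ = 0 := by simp [hℓ]
  have hconst : ∀ t, W t * Complex.exp (-ℓ t) = W t₀ := by
    have hd : ∀ t, HasDerivAt (fun t => W t * Complex.exp (-ℓ t)) 0 t := by
      intro t
      refine ((hW t).fun_mul (hℓd t).fun_neg.cexp).congr_deriv ?_
      have := h0 t
      field_simp
      ring
    intro t
    have := is_const_of_deriv_eq_zero (fun t => (hd t).differentiableAt)
      (fun t => (hd t).deriv) t t₀
    simpa [hℓ0] using this
  have himd : ∀ t, HasDerivAt (fun t => (ℓ t).im) (W' t / W t).im t := fun t =>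
    Complex.imCLM.hasFDerivAt.comp_hasDerivAt t (hℓd t)
  have himc : Continuous fun t => (ℓ t).im :=
    continuous_iff_continuousAt.2 fun t => (himd t).continuousAt
  have hT : t₀ ≤ t₀ + Real.pi / c := by
    have := Real.pi_pos
    have : 0 < Real.pi / c := by positivity
    linarith
  have hgrow : Real.pi ≤ (ℓ (t₀ + Real.pi / c)).im := by
    have hmono : Monotone fun t => (ℓ t).im - c * t := by
      refine monotone_of_hasDerivAt_nonneg
        (fun t => (himd t).sub ((hasDerivAt_id t).const_mul c)) fun t => ?_
      simpa using hang t
    have h1 := hmono hT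
    simp only [hℓ0, Complex.zero_im] at h1
    have h2 : c * (t₀ + Real.pi / c) = c * t₀ + Real.pi := by field_simp
    linarith
  obtain ⟨t, ht, htπ⟩ := intermediate_value_Icc hT himc.continuousOn
    (show Real.pi ∈ Set.Icc _ _ from ⟨by simp [hℓ0, Real.pi_pos.le], hgrow⟩)
  have htne : t₀ ≠ t := by
    rintro rfl
    simp only [hℓ0, Complex.zero_im] at htπ
    exact Real.pi_pos.ne htπ
  refine ⟨t - t₀, sub_pos.2 (lt_of_le_of_ne ht.1 htne), Real.exp (ℓ t).re, Real.exp_pos _, ?_⟩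
  have hexp : Complex.exp (ℓ t) = -(Real.exp (ℓ t).re : ℂ) := by
    rw [← Complex.re_add_im (ℓ t), Complex.exp_add, show (ℓ t).im = Real.pi from htπ,
      Complex.exp_pi_mul_I]
    simp
  rw [add_sub_cancel, ← hconst t, ← neg_mul, ← hexp, mul_left_comm, ← Complex.exp_add]
  simp

/-- The quantities `X`, `U`, `V` on the sphere `X² + 4U² + 4V² = S²`, moving along a level curve
of `(S² - X²)(S² - 4U²)²` around the point `X = U = 0`, reach the point symmetric with respect to
it. -/
theorem exists_half_turn {X U V : ℝ → ℝ} {S : ℝ} (hS : 0 < S) (t₀ : ℝ) (hV : Continuous V)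
    (hX : ∀ t, HasDerivAt X (-(8 / Real.pi) * (U t * V t) / (S ^ 2 - 4 * U t ^ 2)) t)
    (hU : ∀ t, HasDerivAt U (1 / Real.pi * (V t * X t) / (S ^ 2 - X t ^ 2)) t)
    (hsph : ∀ t, X t ^ 2 + 4 * U t ^ 2 + 4 * V t ^ 2 = S ^ 2)
    (hXpos : ∀ t, 0 < S ^ 2 - X t ^ 2) (hUpos : ∀ t, 0 < S ^ 2 - 4 * U t ^ 2)
    (hV0 : 0 < V t₀)
    (hlevel : 4 * S ^ 6 < 27 * ((S ^ 2 - X t₀ ^ 2) * (S ^ 2 - 4 * U t₀ ^ 2) ^ 2)) :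
    ∃ h > 0, X (t₀ + h) = -X t₀ ∧ U (t₀ + h) = -U t₀ ∧ V (t₀ + h) = V t₀ := by
  have hπ := Real.pi_pos
  have hXc : Continuous X := continuous_iff_continuousAt.2 fun t => (hX t).continuousAt
  have hUc : Continuous U := continuous_iff_continuousAt.2 fun t => (hU t).continuousAt
  have hE : ∀ t, (S ^ 2 - X t ^ 2) * (S ^ 2 - 4 * U t ^ 2) ^ 2
      = (S ^ 2 - X t₀ ^ 2) * (S ^ 2 - 4 * U t₀ ^ 2) ^ 2 := by
    have hd : ∀ t, HasDerivAt (fun t => (S ^ 2 - X t ^ 2) * (S ^ 2 - 4 * U t ^ 2) ^ 2) 0 t := by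
      intro t
      refine ((((hX t).fun_pow 2).const_sub (S ^ 2)).fun_mul
        (((((hU t).fun_pow 2).const_mul 4).const_sub (S ^ 2)).fun_pow 2)).congr_deriv ?_
      have h1 := (hXpos t).ne'
      have h2 := (hUpos t).ne'
      field_simp
      ring
    exact fun t => is_const_of_deriv_eq_zero (fun t => (hd t).differentiableAt)
      (fun t => (hd t).deriv) t t₀
  set E := (S ^ 2 - X t₀ ^ 2) * (S ^ 2 - 4 * U t₀ ^ 2) ^ 2 with hEdef
  -- From `E = (4U² + 4V²)(S² - 4U²)²`: the `U²` part is at most `4S⁶/27` and the `V²` part at most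
  -- `4V²S⁴`, which gives `V² ≥ d`.
  set d := (27 * E - 4 * S ^ 6) / (108 * S ^ 4) with hd
  have hdpos : 0 < d := div_pos (by linarith) (by positivity)
  have hVsq : ∀ t, d ≤ V t ^ 2 := by
    intro t
    have h1 := twentySeven_mul_sq_le (sub_pos.1 (hUpos t)).le
    have h2 := hE t
    have h3 : S ^ 2 - X t ^ 2 = 4 * U t ^ 2 + 4 * V t ^ 2 := by linarith [hsph t]
    rw [h3] at h2
    have h4 : (S ^ 2 - 4 * U t ^ 2) ^ 2 ≤ (S ^ 2) ^ 2 :=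
      pow_le_pow_left₀ (hUpos t).le (by nlinarith [sq_nonneg (U t)]) 2
    have h5 := mul_le_mul_of_nonneg_left h4 (sq_nonneg (V t))
    rw [hd, div_le_iff₀ (by positivity)]
    nlinarith
  have hVpos : ∀ t, 0 < V t := by
    intro t
    by_contra hneg
    obtain ⟨s, -, hs⟩ := intermediate_value_uIcc (a := t₀) (b := t) hV.continuousOn
      (show (0 : ℝ) ∈ Set.uIcc (V t₀) (V t) from
        Set.mem_uIcc.2 (Or.inr ⟨not_lt.1 hneg, hV0.le⟩))
    have := hVsq s
    rw [hs] at this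
    linarith
  have hVeq : ∀ t, X t ^ 2 = X t₀ ^ 2 → U t ^ 2 = U t₀ ^ 2 → V t = V t₀ := by
    intro t h1 h2
    have : V t ^ 2 = V t₀ ^ 2 := by linarith [hsph t, hsph t₀]
    exact (sq_eq_sq₀ (hVpos t).le hV0.le).1 this
  -- On the sphere's interior projection `E` attains its maximum `S⁶` only at `X = U = 0`, so an
  -- orbit through this point stays there.
  have hcenter : ∀ t, X t = 0 → U t = 0 → ∀ s, X s = 0 ∧ U s = 0 := by
    intro t h1 h2 s
    have h3 := (hE t).trans (hE s).symm
    rw [h1, h2] at h3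
    by_contra hne
    rw [not_and_or] at hne
    have h4 : (S ^ 2 - 4 * U s ^ 2) ^ 2 ≤ (S ^ 2) ^ 2 :=
      pow_le_pow_left₀ (hUpos s).le (by nlinarith [sq_nonneg (U s)]) 2
    rcases hne with h | h
    · have h5 := mul_lt_mul (show S ^ 2 - X s ^ 2 < S ^ 2 by linarith [sq_pos_of_ne_zero h]) h4
        (pow_pos (hUpos s) 2) (by positivity)
      linarith
    · have h4' : (S ^ 2 - 4 * U s ^ 2) ^ 2 < (S ^ 2) ^ 2 :=
        pow_lt_pow_left₀ (by linarith [sq_pos_of_ne_zero h]) (hUpos s).le two_ne_zero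
      have h5 := mul_lt_mul' (show S ^ 2 - X s ^ 2 ≤ S ^ 2 by linarith [sq_nonneg (X s)]) h4'
        (pow_pos (hUpos s) 2).le (by positivity)
      linarith
  -- At the equilibrium any positive time serves.
  by_cases h0 : X t₀ = 0 ∧ U t₀ = 0
  · obtain ⟨h1, h2⟩ := hcenter t₀ h0.1 h0.2 (t₀ + 1)
    exact ⟨1, one_pos, by simp [h0, h1], by simp [h0, h2], hVeq _ (by rw [h1, h0.1])
      (by rw [h2, h0.2])⟩
  have hne : ∀ t, X t ≠ 0 ∨ U t ≠ 0 := by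
    intro t
    by_contra h
    push Not at h
    exact h0 (hcenter t h.1 h.2 t₀)
  set X' : ℝ → ℝ := fun t => -(8 / Real.pi) * (U t * V t) / (S ^ 2 - 4 * U t ^ 2) with hX'
  set U' : ℝ → ℝ := fun t => 1 / Real.pi * (V t * X t) / (S ^ 2 - X t ^ 2) with hU'
  have hX'c : Continuous X' := Continuous.div (by fun_prop) (by fun_prop) fun t => (hUpos t).ne'
  have hU'c : Continuous U' := Continuous.div (by fun_prop) (by fun_prop) fun t => (hXpos t).ne'
  have h1 : ∀ t, (X t : ℂ) + (2 * U t : ℝ) * I ≠ 0 := by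
    intro t ht
    have hre := congrArg Complex.re ht
    have him := congrArg Complex.im ht
    simp at hre him
    exact (hne t).elim (fun h => h hre) (fun h => h him)
  -- The angular velocity of `X + 2iU` is bounded below using `V ≥ √d` and by enlarging both
  -- denominators to `S²`.
  have h2 : ∀ t, 2 * √d / (Real.pi * S ^ 2) ≤
      (((X' t : ℂ) + (2 * U' t : ℝ) * I) / ((X t : ℂ) + (2 * U t : ℝ) * I)).im := by
    intro t
    have hden : 0 < X t ^ 2 + (2 * U t) ^ 2 := by
      rcases hne t with h | h
      · have := sq_pos_of_ne_zero h
        positivity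
      · have := sq_pos_of_ne_zero h
        positivity
    have him : (((X' t : ℂ) + (2 * U' t : ℝ) * I) / ((X t : ℂ) + (2 * U t : ℝ) * I)).im
        = (X t * (2 * U' t) - 2 * U t * X' t) / (X t ^ 2 + (2 * U t) ^ 2) := by
      rw [Complex.div_im]
      simp only [Complex.normSq_add_mul_I]
      simp
      ring
    rw [him, le_div_iff₀ hden]
    have hsqrt : √d ≤ V t := Real.sqrt_le_iff.2 ⟨(hVpos t).le, hVsq t⟩
    have h1 : X t * (2 * U' t) - 2 * U t * X' t = 2 * V t / Real.pi *
        (X t ^ 2 / (S ^ 2 - X t ^ 2) + 8 * U t ^ 2 / (S ^ 2 - 4 * U t ^ 2)) := by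
      simp only [hX', hU']
      have h1 := (hXpos t).ne'
      have h2 := (hUpos t).ne'
      field_simp
      ring
    have h2 : (X t ^ 2 + (2 * U t) ^ 2) / S ^ 2 ≤
        X t ^ 2 / (S ^ 2 - X t ^ 2) + 8 * U t ^ 2 / (S ^ 2 - 4 * U t ^ 2) := by
      rw [add_div]
      refine add_le_add ?_ ?_
      · exact div_le_div_of_nonneg_left (sq_nonneg _) (hXpos t) (by linarith [sq_nonneg (X t)])
      · exact div_le_div₀ (by positivity) (by linarith [sq_nonneg (U t)]) (hUpos t)
          (by linarith [sq_nonneg (U t)])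
    rw [h1]
    calc 2 * √d / (Real.pi * S ^ 2) * (X t ^ 2 + (2 * U t) ^ 2)
        = 2 * √d / Real.pi * ((X t ^ 2 + (2 * U t) ^ 2) / S ^ 2) := by
          field_simp
      _ ≤ 2 * V t / Real.pi * ((X t ^ 2 + (2 * U t) ^ 2) / S ^ 2) := by gcongr
      _ ≤ _ := by
          have := hVpos t
          gcongr
  obtain ⟨h, hh, r, hr, hW⟩ := exists_opposite_of_angular_velocity
    (W := fun t => (X t : ℂ) + (2 * U t : ℝ) * I)
    (W' := fun t => (X' t : ℂ) + (2 * U' t : ℝ) * I)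
    (by positivity) t₀
    (fun t => (hX t).ofReal_comp.add (((hU t).const_mul 2).ofReal_comp.mul_const I))
    (by fun_prop) h1 h2
  have hre := congrArg Complex.re hW
  have him := congrArg Complex.im hW
  simp at hre him
  have hXr : X (t₀ + h) = -(r * X t₀) := hre
  have hUr : U (t₀ + h) = -(r * U t₀) := by linarith
  have hr1 : r = 1 := by
    have e1 := hXpos (t₀ + h)
    have e2 := hUpos (t₀ + h)
    have e3 := hE (t₀ + h)
    rw [hXr, neg_sq] at e1
    rw [hUr, neg_sq] at e2
    rw [hXr, hUr, neg_sq, neg_sq] at e3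
    exact radial_scale_eq_one hr (hne t₀) (hXpos t₀) (hUpos t₀) e1 e2 e3
  rw [hr1, one_mul] at hXr hUr
  exact ⟨h, hh, hXr, hUr, hVeq _ (by rw [hXr, neg_sq]) (by rw [hUr, neg_sq])⟩

/-! ### Parallelograms in the variables `X`, `U`, `V` -/

theorem normSq_sq_sub_sq (a b : ℂ) : normSq (a ^ 2 - b ^ 2)
    = (normSq a + normSq b) ^ 2 - 4 * (a * (starRingEnd ℂ) b).re ^ 2 := by
  simp only [normSq_apply, pow_two, sub_re, sub_im, mul_re, mul_im, conj_re, conj_im]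
  ring

theorem normSq_mul_normSq (a b : ℂ) : 4 * (normSq a * normSq b)
    = (normSq a + normSq b) ^ 2 - (normSq a - normSq b) ^ 2 := by
  ring

theorem normSq_sub_sq_add (a b : ℂ) :
    (normSq a - normSq b) ^ 2 + 4 * (a * (starRingEnd ℂ) b).re ^ 2
      + 4 * (a * (starRingEnd ℂ) b).im ^ 2 = (normSq a + normSq b) ^ 2 := by
  simp only [normSq_apply, mul_re, mul_im, conj_re, conj_im]
  ring

theorem im_sq_div_sq_sub_sq (a b : ℂ) : (a ^ 2 / (a ^ 2 - b ^ 2)).im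
    = -2 * ((a * (starRingEnd ℂ) b).re * (a * (starRingEnd ℂ) b).im) / normSq (a ^ 2 - b ^ 2) := by
  rw [Complex.div_im, ← sub_div]
  congr 1
  simp only [pow_two, sub_re, sub_im, mul_re, mul_im, conj_re, conj_im]
  ring

theorem re_I_div_mul_conj (x : ℂ) :
    (I / (2 * Real.pi) * (starRingEnd ℂ) x).re = 1 / (2 * Real.pi) * x.im := by
  have hI : I / (2 * Real.pi) = ((1 / (2 * Real.pi) : ℝ) : ℂ) * I := by
    push_cast
    ring
  rw [hI, mul_assoc, Complex.re_ofReal_mul]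
  simp

theorem hasDerivAt_re_mul_conj {f g : ℝ → ℂ} {f' g' : ℂ} {t : ℝ} (hf : HasDerivAt f f' t)
    (hg : HasDerivAt g g' t) : HasDerivAt (fun s => (f s * (starRingEnd ℂ) (g s)).re)
      (f' * (starRingEnd ℂ) (g t) + g' * (starRingEnd ℂ) (f t)).re t := by
  have h := Complex.reCLM.hasFDerivAt.comp_hasDerivAt t (hf.fun_mul hg.star)
  refine h.congr_deriv ?_
  simp
  ring

/-- A parallelogram configuration centred at the origin. -/
structure IsParallelogram (y : Fin 4 → ℂ) : Prop where
  injective : Function.Injective y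
  two : y 2 = -y 0
  three : y 3 = -y 1

namespace IsParallelogram

variable {y : Fin 4 → ℂ}

theorem zero_ne (hy : IsParallelogram y) : y 0 ≠ 0 := fun h =>
  absurd (hy.injective (show y 2 = y 0 by rw [hy.two, h, neg_zero])) (by decide)

theorem one_ne (hy : IsParallelogram y) : y 1 ≠ 0 := fun h =>
  absurd (hy.injective (show y 3 = y 1 by rw [hy.three, h, neg_zero])) (by decide)

theorem sub_ne (hy : IsParallelogram y) : y 0 - y 1 ≠ 0 := fun h =>
  absurd (hy.injective (sub_eq_zero.1 h)) (by decide)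

theorem add_ne (hy : IsParallelogram y) : y 0 + y 1 ≠ 0 := fun h =>
  absurd (hy.injective (show y 0 = y 3 by rw [hy.three]; exact eq_neg_of_add_eq_zero_left h))
    (by decide)

theorem sq_sub_sq_ne (hy : IsParallelogram y) : y 0 ^ 2 - y 1 ^ 2 ≠ 0 := by
  rw [sq_sub_sq]
  exact mul_ne_zero hy.add_ne hy.sub_ne

theorem velocity_zero (hy : IsParallelogram y) : velocity y 0 = I / (2 * Real.pi) *
    (starRingEnd ℂ) ((2 * y 0)⁻¹ + 2 * y 0 / (y 0 ^ 2 - y 1 ^ 2)) := by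
  rw [velocity]
  congr 2
  have h1 := hy.zero_ne
  have h2 := hy.sub_ne
  have h3 := hy.add_ne
  have h4 : (2 * y 0) / (y 0 ^ 2 - y 1 ^ 2) = (y 0 - y 1)⁻¹ + (y 0 + y 1)⁻¹ := by
    rw [sq_sub_sq]
    field_simp
    ring
  rw [h4]
  simp only [Fin.sum_univ_four, hy.two, hy.three, sub_self, inv_zero, sub_neg_eq_add, ← two_mul]
  ring

theorem velocity_one (hy : IsParallelogram y) : velocity y 1 = I / (2 * Real.pi) *
    (starRingEnd ℂ) ((2 * y 1)⁻¹ - 2 * y 1 / (y 0 ^ 2 - y 1 ^ 2)) := by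
  rw [velocity]
  congr 2
  have h1 := hy.zero_ne
  have h2 := hy.sub_ne
  have h3 := hy.add_ne
  have h4 : (2 * y 1) / (y 0 ^ 2 - y 1 ^ 2) = (y 0 - y 1)⁻¹ - (y 0 + y 1)⁻¹ := by
    rw [sq_sub_sq]
    field_simp
    ring
  rw [h4, ← neg_sub (y 1) (y 0), inv_neg]
  simp only [Fin.sum_univ_four, hy.two, hy.three, sub_self, inv_zero, sub_neg_eq_add, ← two_mul]
  rw [add_comm (y 0) (y 1)]
  ring

theorem re_velocity_zero_mul_conj (hy : IsParallelogram y) :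
    (velocity y 0 * (starRingEnd ℂ) (y 0)).re
      = 1 / Real.pi * (y 0 ^ 2 / (y 0 ^ 2 - y 1 ^ 2)).im := by
  have h1 := hy.zero_ne
  have h2 : ((2 * y 0)⁻¹ + 2 * y 0 / (y 0 ^ 2 - y 1 ^ 2)) * y 0
      = ((1 / 2 : ℝ) : ℂ) + ((2 : ℝ) : ℂ) * (y 0 ^ 2 / (y 0 ^ 2 - y 1 ^ 2)) := by
    push_cast
    field_simp
  rw [hy.velocity_zero, mul_assoc, ← map_mul, re_I_div_mul_conj, h2, add_im, ofReal_im,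
    im_ofReal_mul]
  field_simp
  ring

theorem re_velocity_one_mul_conj (hy : IsParallelogram y) :
    (velocity y 1 * (starRingEnd ℂ) (y 1)).re
      = -(1 / Real.pi * (y 0 ^ 2 / (y 0 ^ 2 - y 1 ^ 2)).im) := by
  have h1 := hy.one_ne
  have h0 := hy.sq_sub_sq_ne
  have h2 : ((2 * y 1)⁻¹ - 2 * y 1 / (y 0 ^ 2 - y 1 ^ 2)) * y 1
      = ((5 / 2 : ℝ) : ℂ) - ((2 : ℝ) : ℂ) * (y 0 ^ 2 / (y 0 ^ 2 - y 1 ^ 2)) := by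
    push_cast
    field_simp
    ring
  rw [hy.velocity_one, mul_assoc, ← map_mul, re_I_div_mul_conj, h2, sub_im, ofReal_im,
    im_ofReal_mul]
  field_simp
  ring

theorem re_velocity_mul_conj_add (hy : IsParallelogram y) :
    (velocity y 0 * (starRingEnd ℂ) (y 1) + velocity y 1 * (starRingEnd ℂ) (y 0)).re
      = 1 / Real.pi * ((y 0 * (starRingEnd ℂ) (y 1)).im * (normSq (y 0) - normSq (y 1))) /
        (4 * (normSq (y 0) * normSq (y 1))) := by
  have h0 := hy.zero_ne
  have h1 := hy.one_ne
  have h2 : ((2 * y 0)⁻¹ + 2 * y 0 / (y 0 ^ 2 - y 1 ^ 2)) * y 1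
      + ((2 * y 1)⁻¹ - 2 * y 1 / (y 0 ^ 2 - y 1 ^ 2)) * y 0
      = ((1 / 2 : ℝ) : ℂ) * (y 1 / y 0 + y 0 / y 1) := by
    push_cast
    field_simp
    ring
  have h3 : (y 1 / y 0 + y 0 / y 1).im = (y 0 * (starRingEnd ℂ) (y 1)).im *
      (normSq (y 0) - normSq (y 1)) / (normSq (y 0) * normSq (y 1)) := by
    have h4 : normSq (y 0) ≠ 0 := by simpa using h0
    have h5 : normSq (y 1) ≠ 0 := by simpa using h1
    rw [add_im, Complex.div_im, Complex.div_im, mul_im, conj_re, conj_im]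
    field_simp
    ring
  rw [hy.velocity_zero, hy.velocity_one, mul_assoc, mul_assoc, ← map_mul, ← map_mul, ← mul_add,
    ← map_add, re_I_div_mul_conj, h2, im_ofReal_mul, h3]
  field_simp
  ring

theorem integralI_eq (hy : IsParallelogram y) :
    integralI (fun _ => 1) y = 2 * (normSq (y 0) + normSq (y 1)) := by
  simp only [integralI, Fin.sum_univ_four, hy.two, hy.three, normSq_apply, neg_re, neg_im]
  ring

theorem hamiltonian_eq (hy : IsParallelogram y) : hamiltonian (fun _ => 1) y =
    -(1 / (4 * Real.pi)) * Real.log (16 * (normSq (y 0) * normSq (y 1)) *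
      normSq (y 0 ^ 2 - y 1 ^ 2) ^ 2) := by
  have h0 : normSq (y 0) ≠ 0 := by simpa using hy.zero_ne
  have h1 : normSq (y 1) ≠ 0 := by simpa using hy.one_ne
  have h2 : normSq (y 0 - y 1) ≠ 0 := by simpa using hy.sub_ne
  have h3 : normSq (y 0 + y 1) ≠ 0 := by simpa using hy.add_ne
  have e1 : ∀ a : ℂ, a + a = (2 : ℝ) * a := fun a => by push_cast; ring
  have e2 : normSq (-y 0 - y 1) = normSq (y 0 + y 1) := by
    rw [← normSq_neg]
    ring_nf
  have e3 : normSq (-y 0 + y 1) = normSq (y 0 - y 1) := by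
    rw [← normSq_neg]
    ring_nf
  have e4 : normSq (y 1 + y 0) = normSq (y 0 + y 1) := by rw [add_comm]
  have e5 : normSq (y 1 - y 0) = normSq (y 0 - y 1) := by
    rw [← normSq_neg]
    ring_nf
  have e6 : normSq (-y 1 - y 0) = normSq (y 0 + y 1) := by
    rw [← normSq_neg]
    ring_nf
  have e7 : normSq (-y 1 + y 0) = normSq (y 0 - y 1) := by ring_nf
  have e8 : ∀ a : ℂ, normSq (-a - a) = normSq (a + a) := fun a => by
    rw [← normSq_neg]
    ring_nf
  have e9 : normSq (y 0 ^ 2 - y 1 ^ 2) = normSq (y 0 + y 1) * normSq (y 0 - y 1) := by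
    rw [sq_sub_sq, map_mul]
  rw [hamiltonian_one_eq]
  simp only [Fin.sum_univ_four, hy.two, hy.three, ← normSq_eq_norm_sq, sub_self, sub_neg_eq_add,
    map_zero, Real.log_zero, e2, e3, e4, e5, e6, e7, e8, e9, e1, map_mul, normSq_ofReal]
  have l1 : ∀ x : ℝ, x ≠ 0 → Real.log (2 * 2 * x) = 2 * Real.log 2 + Real.log x := fun x hx => by
    rw [Real.log_mul (by norm_num) hx, Real.log_mul (by norm_num) (by norm_num), two_mul]
  have l2 : Real.log 16 = 4 * Real.log 2 := by
    rw [show (16 : ℝ) = 2 ^ 4 by norm_num, Real.log_pow]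
    norm_num
  rw [l1 _ h0, l1 _ h1, Real.log_mul (by positivity) (by positivity),
    Real.log_mul (by norm_num) (by positivity), Real.log_mul h0 h1, Real.log_pow,
    Real.log_mul h3 h2, l2]
  simp only [neg_add_cancel, map_zero, Real.log_zero]
  push_cast
  ring

theorem level_of_hamiltonian_lt (hy : IsParallelogram y)
    (h : 2 * Real.pi / 3 * hamiltonian (fun _ => 1) y
        + Real.log (integralI (fun _ => 1) y) < Real.log 108 / 6) :
    4 * (normSq (y 0) + normSq (y 1)) ^ 6
      < 27 * (4 * (normSq (y 0) * normSq (y 1)) * normSq (y 0 ^ 2 - y 1 ^ 2) ^ 2) := by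
  have h0 : 0 < normSq (y 0) := normSq_pos.2 hy.zero_ne
  have h1 : 0 < normSq (y 1) := normSq_pos.2 hy.one_ne
  have h2 : 0 < normSq (y 0 ^ 2 - y 1 ^ 2) := normSq_pos.2 hy.sq_sub_sq_ne
  rw [hy.hamiltonian_eq, hy.integralI_eq] at h
  set L := 16 * (normSq (y 0) * normSq (y 1)) * normSq (y 0 ^ 2 - y 1 ^ 2) ^ 2 with hL
  have hLpos : 0 < L := by positivity
  have h3 : 2 * Real.pi / 3 * (-(1 / (4 * Real.pi)) * Real.log L) = -(Real.log L / 6) := by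
    have := Real.pi_pos.ne'
    field_simp
    ring
  rw [h3] at h
  -- Since `I = 2S` and `L = 4E`, the inequality `(2S)⁶ < 108 L` is `4S⁶ < 27E`.
  have h4 : Real.log ((2 * (normSq (y 0) + normSq (y 1))) ^ 6) < Real.log (108 * L) := by
    rw [Real.log_pow, Real.log_mul (by norm_num) hLpos.ne']
    push_cast
    linarith
  have h5 := (Real.log_lt_log_iff (by positivity) (by positivity)).1 h4
  rw [mul_pow] at h5
  linarith

/-- If `V = 0`, the sphere relation turns `4|y 0|²|y 1|²` into `4U²`, and `twentySeven_mul_sq_le`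
contradicts the level bound. -/
theorem im_ne_zero_of_level (hy : IsParallelogram y)
    (h : 4 * (normSq (y 0) + normSq (y 1)) ^ 6
      < 27 * (4 * (normSq (y 0) * normSq (y 1)) * normSq (y 0 ^ 2 - y 1 ^ 2) ^ 2)) :
    (y 0 * (starRingEnd ℂ) (y 1)).im ≠ 0 := by
  intro hV
  have h1 := normSq_sub_sq_add (y 0) (y 1)
  have h2 : 0 < normSq (y 0 ^ 2 - y 1 ^ 2) := normSq_pos.2 hy.sq_sub_sq_ne
  rw [hV] at h1
  rw [normSq_sq_sub_sq] at h2 h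
  have h3 := twentySeven_mul_sq_le (sub_pos.1 h2).le
  have h4 : 4 * (normSq (y 0) * normSq (y 1)) = 4 * (y 0 * (starRingEnd ℂ) (y 1)).re ^ 2 := by
    linarith [normSq_mul_normSq (y 0) (y 1)]
  rw [h4] at h
  linarith

end IsParallelogram

/-! ### Exchange of the diagonals -/

/-- After a suitable time the two diagonals of the parallelogram have changed places, up to a
rotation. -/
theorem exists_swap_of_level {y : ℝ → Fin 4 → ℂ} (hy : IsUnitMotion y)
    (hp : ∀ t, IsParallelogram (y t)) (t₀ : ℝ)
    (hpos : 0 < (y t₀ 0 * (starRingEnd ℂ) (y t₀ 1)).im)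
    (hlevel : 4 * (normSq (y t₀ 0) + normSq (y t₀ 1)) ^ 6
      < 27 * (4 * (normSq (y t₀ 0) * normSq (y t₀ 1))
        * normSq (y t₀ 0 ^ 2 - y t₀ 1 ^ 2) ^ 2)) :
    ∃ h > 0, ∃ w : ℂ, ‖w‖ = 1 ∧ y (t₀ + h) 0 = w * y t₀ 1 ∧ y (t₀ + h) 1 = -(w * y t₀ 0) := by
  have hN : ∀ (k : Fin 4) (t : ℝ), HasDerivAt (fun s => normSq (y s k))
      (2 * (velocity (y t) k * (starRingEnd ℂ) (y t k)).re) t := by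
    intro k t
    have h := hasDerivAt_re_mul_conj (hy.hasDerivAt t k) (hy.hasDerivAt t k)
    simp only [mul_conj, ofReal_re] at h
    exact h.congr_deriv (by rw [add_re, two_mul])
  set S := normSq (y t₀ 0) + normSq (y t₀ 1) with hS
  have hSt : ∀ t, normSq (y t 0) + normSq (y t 1) = S := by
    have hd : ∀ t, HasDerivAt (fun t => normSq (y t 0) + normSq (y t 1)) 0 t := by
      intro t
      refine ((hN 0 t).add (hN 1 t)).congr_deriv ?_
      rw [(hp t).re_velocity_zero_mul_conj, (hp t).re_velocity_one_mul_conj]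
      ring
    exact fun t => is_const_of_deriv_eq_zero (fun t => (hd t).differentiableAt)
      (fun t => (hd t).deriv) t t₀
  have h0 : ∀ t, 0 < normSq (y t 0) := fun t => normSq_pos.2 (hp t).zero_ne
  have h1 : ∀ t, 0 < normSq (y t 1) := fun t => normSq_pos.2 (hp t).one_ne
  have hprod : ∀ t, S ^ 2 - (normSq (y t 0) - normSq (y t 1)) ^ 2
      = 4 * (normSq (y t 0) * normSq (y t 1)) := by
    intro t
    rw [normSq_mul_normSq, hSt]
  have hdiff : ∀ t, S ^ 2 - 4 * (y t 0 * (starRingEnd ℂ) (y t 1)).re ^ 2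
      = normSq (y t 0 ^ 2 - y t 1 ^ 2) := by
    intro t
    rw [normSq_sq_sub_sq, hSt]
  have hc : ∀ k, Continuous fun t => y t k := fun k =>
    continuous_iff_continuousAt.2 fun t => (hy.hasDerivAt t k).continuousAt
  have hc0 := hc 0
  have hc1 := hc 1
  obtain ⟨h, hh, hX, hU, hV⟩ := exists_half_turn
    (X := fun t => normSq (y t 0) - normSq (y t 1))
    (U := fun t => (y t 0 * (starRingEnd ℂ) (y t 1)).re)
    (V := fun t => (y t 0 * (starRingEnd ℂ) (y t 1)).im) (S := S) (add_pos (h0 t₀) (h1 t₀)) t₀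
    (by fun_prop)
    (fun t => ((hN 0 t).sub (hN 1 t)).congr_deriv (by
      rw [(hp t).re_velocity_zero_mul_conj, (hp t).re_velocity_one_mul_conj,
        im_sq_div_sq_sub_sq, hdiff]
      ring))
    (fun t => (hasDerivAt_re_mul_conj (hy.hasDerivAt t 0) (hy.hasDerivAt t 1)).congr_deriv (by
      rw [(hp t).re_velocity_mul_conj_add, hprod]))
    (fun t => by rw [normSq_sub_sq_add, hSt])
    (fun t => by have := h0 t; have := h1 t; rw [hprod]; positivity)
    (fun t => by rw [hdiff]; exact normSq_pos.2 (hp t).sq_sub_sq_ne) hpos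
    (by rw [hprod, hdiff]; exact hlevel)
  have hn0 : normSq (y (t₀ + h) 0) = normSq (y t₀ 1) := by
    linarith [hSt (t₀ + h)]
  -- Negating `U` and keeping `V` sends `U + iV` to minus its conjugate.
  have hcross : y (t₀ + h) 0 * (starRingEnd ℂ) (y (t₀ + h) 1)
      = -((starRingEnd ℂ) (y t₀ 0) * y t₀ 1) := by
    apply Complex.ext
    · rw [hU]
      simp
    · rw [hV]
      simp
      ring
  have hb := (hp t₀).one_ne
  have hw : ‖y (t₀ + h) 0 / y t₀ 1‖ = 1 := by
    rw [norm_div, Complex.norm_def, Complex.norm_def, hn0]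
    exact div_self (Real.sqrt_pos.2 (h1 t₀)).ne'
  refine ⟨h, hh, y (t₀ + h) 0 / y t₀ 1, hw, (div_mul_cancel₀ _ hb).symm, ?_⟩
  set w := y (t₀ + h) 0 / y t₀ 1 with hwdef
  have hw0 : w ≠ 0 := norm_ne_zero_iff.1 (hw ▸ one_ne_zero)
  have h2 : y (t₀ + h) 0 = w * y t₀ 1 := (div_mul_cancel₀ _ hb).symm
  have h3 : w * (starRingEnd ℂ) (y (t₀ + h) 1) = -(starRingEnd ℂ) (y t₀ 0) := by
    rw [h2] at hcross
    apply mul_right_cancel₀ hb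
    linear_combination hcross
  have h4 := congrArg (starRingEnd ℂ) h3
  rw [map_mul, map_neg, conj_conj, conj_conj, ← Complex.inv_eq_conj hw] at h4
  rw [inv_mul_eq_iff_eq_mul₀ hw0] at h4
  rw [h4, mul_neg]

theorem isSimpleRelativeChoreography_of_level {y : ℝ → Fin 4 → ℂ} (hy : IsUnitMotion y)
    {t₀ : ℝ} (hp : IsParallelogram (y t₀))
    (hpos : 0 < (y t₀ 0 * (starRingEnd ℂ) (y t₀ 1)).im)
    (hlevel : 4 * (normSq (y t₀ 0) + normSq (y t₀ 1)) ^ 6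
      < 27 * (4 * (normSq (y t₀ 0) * normSq (y t₀ 1))
        * normSq (y t₀ 0 ^ 2 - y t₀ 1 ^ 2) ^ 2)) (e : Equiv.Perm (Fin 4)) :
    IsSimpleRelativeChoreography fun t k => y t (e k) := by
  -- Central symmetry is a rotation by `-1` with relabelling `k ↦ k + 2` and time shift `0`, so it
  -- persists.
  have hneg : ∀ t k, y t k = -y t (k + 2) := by
    intro t k
    have := hy.rotate_comp_perm_eq (w := -1) (by simp) (Equiv.addRight (2 : Fin 4)) (h := 0)
      (t₀ := t₀) (fun k => by
        rw [add_zero, neg_one_mul]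
        fin_cases k <;> simp [hp.two, hp.three]) t k
    simpa using this
  have hpt : ∀ t, IsParallelogram (y t) := fun t =>
    ⟨hy.injective t, hneg t 2, hneg t 3⟩
  obtain ⟨h, hh, w, hw, hs0, hs1⟩ := exists_swap_of_level hy hpt t₀ hpos hlevel
  refine isSimpleRelativeChoreography_of_shift
    (continuous_iff_continuousAt.2 fun t => (hy.hasDerivAt t 0).continuousAt) e hh hw fun t k =>
      hy.rotate_comp_perm_eq hw (Equiv.addRight (1 : Fin 4)) (t₀ := t₀) (fun k => ?_) t k
  fin_cases k
  · simpa using hs0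
  · simpa [hp.two] using hs1
  · simp [hp.three, (hpt (t₀ + h)).two, hs0]
  · simp [(hpt (t₀ + h)).three, hs1]

/-! ### Labelling the vertices -/

/-- An involution of four points has an even number of fixed points; having at most one, it has none
and is a product of two transpositions. -/
theorem exists_perm_of_involutive : ∀ σ : Equiv.Perm (Fin 4), (∀ i, σ (σ i) = i) →
    (∀ i j, σ i = i → σ j = j → i = j) →
      ∃ e : Equiv.Perm (Fin 4), σ (e 0) = e 2 ∧ σ (e 1) = e 3 := by
  decide

/-- Four distinct points forming a centrosymmetric configuration with centroid at the origin are
the vertices of a parallelogram, in some order. -/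
theorem IsCentrosymmetric.exists_isParallelogram {z : Fin 4 → ℂ} (hz : Function.Injective z)
    (hsymm : IsCentrosymmetric z) (hsum : ∑ i, z i = 0) :
    ∃ e : Equiv.Perm (Fin 4), IsParallelogram fun k => z (e k) := by
  obtain ⟨c, σ, hσ⟩ := hsymm
  have hc : c = 0 := by
    have h1 := Equiv.sum_comp σ z
    simp only [hσ, Finset.sum_sub_distrib, hsum, sub_zero] at h1
    simpa using h1
  simp only [hc, mul_zero, zero_sub] at hσ
  have hfix : ∀ i, σ i = i → z i = 0 := by
    intro i hi
    have := hσ i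
    rw [hi] at this
    exact self_eq_neg.1 this
  obtain ⟨e, h02, h13⟩ := exists_perm_of_involutive σ
    (fun i => hz (by rw [hσ, hσ, neg_neg]))
    (fun i j hi hj => hz (by rw [hfix i hi, hfix j hj]))
  exact ⟨e, hz.comp e.injective, by rw [← h02, hσ], by rw [← h13, hσ]⟩

end PointVortex

theorem theorem2 (z : ℝ → Fin 4 → ℂ)
    (hz : PointVortex.IsMotion (fun _ => 1) z) (t₀ : ℝ)
    (hQ : PointVortex.integralQ (fun _ => 1) (z t₀) = 0)
    (hP : PointVortex.integralP (fun _ => 1) (z t₀) = 0)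
    (hsymm : PointVortex.IsCentrosymmetric (z t₀))
    (hHI : 2 * Real.pi / 3 * PointVortex.hamiltonian (fun _ => 1) (z t₀)
        + Real.log (PointVortex.integralI (fun _ => 1) (z t₀)) < Real.log 108 / 6) :
    PointVortex.IsSimpleRelativeChoreography z := by
  have hsum : ∑ i, z t₀ i = 0 := by
    apply Complex.ext
    · simpa [PointVortex.integralQ] using hQ
    · simpa [PointVortex.integralP] using hP
  obtain ⟨e₁, hp₁⟩ := hsymm.exists_isParallelogram (hz.noCollision t₀) hsum
  have hlevel : ∀ e : Equiv.Perm (Fin 4), PointVortex.IsParallelogram (fun k => z t₀ (e k)) → _ :=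
    fun e hp => hp.level_of_hamiltonian_lt (by
      rw [PointVortex.hamiltonian_one_comp]
      have hI : PointVortex.integralI (fun _ => 1) (fun k => z t₀ (e k))
          = PointVortex.integralI (fun _ => 1) (z t₀) :=
        Equiv.sum_comp e fun i => 1 * ((z t₀ i).re ^ 2 + (z t₀ i).im ^ 2)
      rwa [hI])
  obtain ⟨e, hp, hpos⟩ : ∃ e : Equiv.Perm (Fin 4),
      PointVortex.IsParallelogram (fun k => z t₀ (e k)) ∧
        0 < (z t₀ (e 0) * (starRingEnd ℂ) (z t₀ (e 1))).im := by
    -- Exchanging the labels `1` and `3` replaces `y 1` by `-y 1` and so flips the sign of `V`.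
    rcases lt_or_gt_of_ne (hp₁.im_ne_zero_of_level (hlevel e₁ hp₁)) with hV | hV
    · have h0 : Equiv.swap (1 : Fin 4) 3 0 = 0 := by decide
      have h2 : Equiv.swap (1 : Fin 4) 3 2 = 2 := by decide
      refine ⟨(Equiv.swap 1 3).trans e₁, ⟨?_, ?_, ?_⟩, ?_⟩
      · exact (hz.noCollision t₀).comp (Equiv.injective _)
      · simpa [h0, h2] using hp₁.two
      · simpa using (neg_eq_iff_eq_neg.2 hp₁.three).symm
      · have h3 : z t₀ (e₁ 3) = -z t₀ (e₁ 1) := hp₁.three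
        simp only [Equiv.trans_apply, h0, Equiv.swap_apply_left, h3, map_neg, mul_neg,
          Complex.neg_im]
        exact neg_pos.2 hV
    · exact ⟨e₁, hp₁, hV⟩
  have hy : PointVortex.IsUnitMotion fun t k => z t (e k) := by
    simpa using hz.isUnitMotion.rotate_comp_perm (w := 1) (by simp) e
  simpa using PointVortex.isSimpleRelativeChoreography_of_level hy hp hpos (hlevel e hp) e.symm
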